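/- A plain machine is a partial computable function $U$ that maps a pair $(p,y)$ of binary strings (a program $p$ and a condition $y$) to a binary string, and the plain Kolmogorov complexity relative to $U$ is $C_U(x\mid y)=\min\{|p| : U(p,y)=x\}$ (infinite if there is no such $p$). Let $U$ be an optimal plain machine, that is, for every plain machine $V$ there is a constant $d$ with $C_U(x\mid y)\le C_V(x\mid y)+d$ for all strings $x,y$. Write $C(x\mid y)=C_U(x\mid y)$ and $C(x)=C(x\mid \text{empty string})$, and identify natural numbers with their binary representations. Then there is a constant $c$ (depending only on $U$) such that for every $n$ there is a binary string $x$ of length $n$ with $$C(C(x)\mid x)\ \ge\ \log_2 n-c .$$ -/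

import Mathlib

/-- The plain conditional complexity `C_U(x | y) = min { |p| : U(p, y) = x }` of the binary string
`x` given the binary string `y`, relative to the machine `U`, where `U p y` is the (possibly
undefined) output of `U` on program `p` and condition `y`.
Its value is `⊤` if no program works. -/
noncomputable def plainComplexity (U : List Bool → List Bool →. List Bool)
    (x y : List Bool) : ℕ∞ :=
  ⨅ p ∈ {p : List Bool | x ∈ U p y}, (p.length : ℕ∞)

/-- `U` is a plain machine (a partial computable function of program and condition) whose
complexity is minimal, up to an additive constant, among all plain machines. -/
def IsOptimalMachine (U : List Bool → List Bool →. List Bool) : Prop :=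
  Partrec₂ U ∧
    ∀ V : List Bool → List Bool →. List Bool, Partrec₂ V →
      ∃ d : ℕ, ∀ x y : List Bool, plainComplexity U x y ≤ plainComplexity V x y + d

/-!
Suppose that `C(x)` has complexity less than `r` given `x` for every `x` of length `n`. We play a
game against `U` with a machine `V` of our own, which `U` simulates with constant overhead.
Row `j` consists of the programs of length less than `M * j`, where `M` exceeds the overhead, and
the rows `J ≤ j < 2 * J` with `J = 2 ^ (r + 1)` are played downwards. At level `s`, a row is heavy
if `U` spends a fraction of at least `2 ^ (-s)` of its programs there on strings of length `n`. In a
light row most surviving strings have complexity at least `M * j`; `V` then describes about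
`2 ^ (M * j - s)` of them by strings of length about `M * j`. This makes the complexity of each of
them drop below `M * j`, to a value that is new and, by assumption, simple given the string. Since
fewer than `2 ^ r` numbers are simple given a string, fewer than `2 ^ r` rows are light.

To contradict this, let `s` be least such that at least half of the rows are heavy at level `s + 1`.
By minimality at least half of the rows, `2 ^ r` of them, are light at level `s`. On the other hand,
`U` itself spends a fraction of order `2 ^ (-s)` of its programs on the length `n`. Summed over all
games these fractions are bounded, so `V` can afford to play every game whose level meets this
condition, and it need not know which `s` is the least one.
-/

open Finset

theorem countP_eq_card_filter_toFinset {β : Type*} [DecidableEq β] {l : List β} (hl : l.Nodup)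
    (p : β → Prop) [DecidablePred p] : l.countP (p ·) = #{b ∈ l.toFinset | p b} := by
  rw [List.countP_eq_length_filter, ← List.toFinset_card_of_nodup (hl.filter _),
    List.toFinset_filter]
  simp only [decide_eq_true_eq]

section Computability

variable {α β σ : Type*} [Primcodable α] [Primcodable β] [Primcodable σ]

theorem exists_primrec_stages {f : α →. σ} (hf : Partrec f) :
    ∃ u : α → ℕ → Option σ, Primrec₂ u ∧
      (∀ ⦃a t t' b⦄, t ≤ t' → u a t = some b → u a t' = some b) ∧
      ∀ a b, b ∈ f a ↔ ∃ t, u a t = some b := by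
  obtain ⟨c, hc⟩ := Nat.Partrec.Code.exists_code.1 hf
  have hmem : ∀ a b, b ∈ f a ↔ ∃ t, Encodable.encode b ∈ c.evaln t (Encodable.encode a) := by
    intro a b
    rw [← Nat.Partrec.Code.evaln_complete, hc]
    simp
  refine ⟨fun a t => (c.evaln t (Encodable.encode a)).bind Encodable.decode, ?_, ?_, ?_⟩
  · exact Primrec.option_bind
      (Nat.Partrec.Code.primrec_evaln.comp
        ((Primrec.snd.pair (Primrec.const c)).pair (Primrec.encode.comp Primrec.fst)))
      (Primrec.decode.comp Primrec.snd)
  · intro a t t' b ht h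
    obtain ⟨k, hk, hb⟩ := Option.bind_eq_some_iff.1 h
    exact Option.bind_eq_some_iff.2 ⟨k, Nat.Partrec.Code.evaln_mono ht hk, hb⟩
  · intro a b
    rw [hmem]
    refine exists_congr fun t => ?_
    rw [Option.bind_eq_some_iff]
    refine ⟨fun h => ⟨_, h, Encodable.encodek b⟩, ?_⟩
    rintro ⟨k, hk, hb⟩
    have hkf := Nat.Partrec.Code.evaln_sound hk
    rw [hc] at hkf
    simp only [Encodable.encodek, Part.coe_some, Part.bind_some, Part.mem_map_iff] at hkf
    obtain ⟨w, -, rfl⟩ := hkf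
    rw [Encodable.encodek, Option.some_inj] at hb
    rwa [← hb]

theorem rePred_exists_of_primrecRel {P : α → ℕ → Prop} (hP : PrimrecRel P) :
    REPred fun a => ∃ t, P a t := by
  classical
  have hdec : Computable₂ fun a t => decide (P a t) := hP.decide.to_comp
  refine (Partrec.rfind hdec.partrec₂).dom_re.of_eq fun a => ?_
  simp [Nat.rfind_dom]

theorem exists_primrec_enumeration_of_rePred {R : α → β → Prop}
    (hR : REPred fun a : α × β => R a.1 a.2) :
    ∃ e : α → ℕ → Option β, Primrec₂ e ∧ ∀ a b, R a b ↔ ∃ i, e a i = some b := by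
  obtain ⟨u, hu, -, hspec⟩ := exists_primrec_stages hR
  have hRu : ∀ a b, R a b ↔ ∃ t, u (a, b) t = some () := fun a b => by
    rw [← hspec (a, b) ()]
    simp
  -- Candidate `i` codes an element together with the stage at which it is confirmed.
  refine ⟨fun a i => (Encodable.decode i : Option (β × ℕ)).bind fun w =>
    (u (a, w.1) w.2).map fun _ => w.1, ?_, fun a b => (hRu a b).trans ⟨?_, ?_⟩⟩
  · refine Primrec.option_bind (Primrec.decode.comp Primrec.snd) (Primrec.option_map
      (hu.comp ((Primrec.fst.comp Primrec.fst).pair (Primrec.fst.comp Primrec.snd))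
        (Primrec.snd.comp Primrec.snd)) ?_)
    exact Primrec.fst.comp (Primrec.snd.comp Primrec.fst)
  · rintro ⟨t, ht⟩
    exact ⟨Encodable.encode (b, t), by simp [Encodable.encodek, ht]⟩
  · rintro ⟨i, hi⟩
    obtain ⟨⟨b', t⟩, -, hb⟩ := Option.bind_eq_some_iff.1 hi
    obtain ⟨_, ht, rfl⟩ := Option.map_eq_some_iff.1 hb
    exact ⟨t, ht⟩

theorem primrec_countP {f : α → List β} {R : α → β → Prop} [DecidableRel R]
    (hf : Primrec f) (hR : PrimrecRel R) : Primrec fun a => (f a).countP (R a ·) := by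
  simp only [List.countP_eq_length_filter]
  exact Primrec.list_length.comp ((PrimrecRel.listFilter hR.swap).comp hf Primrec.id)

theorem primrec_card_filter_toFinset [DecidableEq β] {f : α → List β} {R : α → β → Prop}
    [DecidableRel R] (hnodup : ∀ a, (f a).Nodup) (hf : Primrec f) (hR : PrimrecRel R) :
    Primrec fun a => #{b ∈ (f a).toFinset | R a b} :=
  (primrec_countP hf hR).of_eq fun a => countP_eq_card_filter_toFinset (hnodup a) _

theorem primrec_card_filter_Ico {f g : α → ℕ} {R : α → ℕ → Prop} [DecidableRel R]
    (hf : Primrec f) (hg : Primrec g) (hR : PrimrecRel R) :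
    Primrec fun a => #{i ∈ Ico (f a) (g a) | R a i} := by
  have hmem : PrimrecRel fun a i => f a ≤ i ∧ R a i :=
    PrimrecPred.and (Primrec.nat_le.comp (hf.comp Primrec.fst) Primrec.snd) hR
  refine (primrec_card_filter_toFinset (fun _ => List.nodup_range)
    (Primrec.list_range.comp hg) hmem).of_eq fun a => ?_
  congr 1
  ext i
  simp only [List.toFinset_range, mem_filter, mem_range, mem_Ico]
  tauto

theorem primrecPred_exists_mem {f : α → List β} {R : α → β → Prop}
    (hf : Primrec f) (hR : PrimrecRel R) : PrimrecPred fun a => ∃ b ∈ f a, R a b :=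
  (PrimrecRel.exists_mem_list hR.swap).comp hf Primrec.id

theorem primrec_nat_pow : Primrec₂ ((· ^ ·) : ℕ → ℕ → ℕ) :=
  Primrec₂.unpaired'.1 Nat.Primrec.pow

theorem primrec_nat_log_two : Primrec (Nat.log 2) := by
  have hpow : PrimrecRel fun n k : ℕ => 2 ^ k ≤ n :=
    Primrec.nat_le.comp (primrec_nat_pow.comp (Primrec.const 2) Primrec.snd) Primrec.fst
  refine (Primrec.nat_findGreatest Primrec.id hpow).of_eq fun n => ?_
  rw [id_eq, Nat.findGreatest_eq_iff]
  refine ⟨Nat.log_le_self 2 n, fun h => Nat.pow_log_le_self 2 ?_, fun k hk _ => ?_⟩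
  · rintro rfl
    simp at h
  · exact (Nat.lt_pow_of_log_lt one_lt_two hk).not_ge

theorem primrec_nat_bits : Primrec Nat.bits := by
  have hstep : Primrec₂ fun (_ : Unit) (l : List (List Bool)) =>
      if l.length = 0 then some [] else l[l.length.div2]?.map (List.cons l.length.bodd) := by
    have hlen : Primrec fun a : Unit × List (List Bool) => a.2.length :=
      Primrec.list_length.comp Primrec.snd
    exact Primrec.ite (Primrec.eq.comp hlen (Primrec.const 0)) (Primrec.const _)
      (Primrec.option_map (Primrec.list_getElem?.comp Primrec.snd (Primrec.nat_div2.comp hlen))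
        (Primrec.list_cons.comp (Primrec.nat_bodd.comp (hlen.comp Primrec.fst)) Primrec.snd))
  refine (Primrec.nat_strong_rec (fun _ => Nat.bits) hstep fun _ n => ?_).comp
    (Primrec.const ()) Primrec.id
  rcases eq_or_ne n 0 with rfl | hn
  · simp
  · have hbits : n.bits = n.bodd :: n.div2.bits := by
      conv_lhs => rw [← Nat.bit_bodd_div2 n]
      refine Nat.bits_append_bit _ _ fun h => ?_
      have := Nat.bodd_add_div2 n
      rcases hb : n.bodd <;> simp_all
    simp [hn, hbits, Nat.div2_val, Nat.div_lt_self (Nat.pos_of_ne_zero hn) one_lt_two]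

end Computability

section Strings

/-- The binary strings of length `n`, in lexicographic order. -/
def stringsOfLength : ℕ → List (List Bool)
  | 0 => [[]]
  | n + 1 => (stringsOfLength n).map (List.cons false) ++ (stringsOfLength n).map (List.cons true)

/-- The binary strings of length less than `n`, by increasing length. -/
def stringsLT : ℕ → List (List Bool)
  | 0 => []
  | n + 1 => stringsLT n ++ stringsOfLength n

theorem mem_stringsOfLength {n : ℕ} {x : List Bool} : x ∈ stringsOfLength n ↔ x.length = n := by
  induction n generalizing x with
  | zero => simp [stringsOfLength]
  | succ n ih => rcases x with _ | ⟨_ | _, x⟩ <;> simp [stringsOfLength, ih]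

theorem length_stringsOfLength (n : ℕ) : (stringsOfLength n).length = 2 ^ n := by
  induction n with
  | zero => rfl
  | succ n ih => simp [stringsOfLength, ih, pow_succ, mul_two]

theorem nodup_stringsOfLength (n : ℕ) : (stringsOfLength n).Nodup := by
  induction n with
  | zero => simp [stringsOfLength]
  | succ n ih =>
    refine (ih.map List.cons_injective).append (ih.map List.cons_injective) ?_
    simp [List.disjoint_left]

theorem mem_stringsLT {n : ℕ} {x : List Bool} : x ∈ stringsLT n ↔ x.length < n := by
  induction n with
  | zero => simp [stringsLT]
  | succ n ih => simp [stringsLT, ih, mem_stringsOfLength, le_iff_lt_or_eq]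

theorem length_stringsLT_lt (n : ℕ) : (stringsLT n).length < 2 ^ n := by
  induction n with
  | zero => simp [stringsLT]
  | succ n ih =>
    rw [stringsLT, List.length_append, length_stringsOfLength, pow_succ]
    omega

theorem nodup_stringsLT (n : ℕ) : (stringsLT n).Nodup := by
  induction n with
  | zero => simp [stringsLT]
  | succ n ih =>
    refine ih.append (nodup_stringsOfLength n) fun x hx hx' => ?_
    exact (mem_stringsLT.1 hx).ne (mem_stringsOfLength.1 hx')

theorem primrec_stringsOfLength : Primrec stringsOfLength := by
  have hcons (b : Bool) : Primrec₂ fun (_ : ℕ) (l : List (List Bool)) => l.map (List.cons b) :=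
    Primrec.list_map Primrec.snd (Primrec.list_cons.comp (Primrec.const b) Primrec.snd).to₂
  have happend : Primrec₂ fun (_ : ℕ) (l : List (List Bool)) =>
      l.map (List.cons false) ++ l.map (List.cons true) :=
    Primrec.list_append.comp (hcons false) (hcons true)
  refine (Primrec.nat_rec₁ [[]] happend).of_eq fun n => ?_
  induction n with
  | zero => rfl
  | succ n ih => simp only [stringsOfLength, ← ih]

theorem primrec_stringsLT : Primrec stringsLT := by
  have happend : Primrec₂ fun (n : ℕ) (l : List (List Bool)) => l ++ stringsOfLength n :=
    Primrec.list_append.comp Primrec.snd (primrec_stringsOfLength.comp Primrec.fst)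
  refine (Primrec.nat_rec₁ [] happend).of_eq fun n => ?_
  induction n with
  | zero => rfl
  | succ n ih => simp only [stringsLT, ← ih]

end Strings

section Quota

variable {K X : Type*} [DecidableEq K] [DecidableEq X]

/-- Appends the request `w = (k, x)` to the list `L` of granted ones, unless it has already been
granted or the key `k` has exhausted its quota `q`. -/
def grantStep (q : ℕ) (L : List (K × X)) (w : K × X) : List (K × X) :=
  if w ∉ L ∧ L.countP (·.1 = w.1) < q then L ++ [w] else L

/-- The list of the requests granted among the first `m` entries of the request sequence `req`,
when at most `quota k` requests with key `k` may be granted. -/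
def grantList (quota : K → ℕ) (req : ℕ → Option (K × X)) : ℕ → List (K × X)
  | 0 => []
  | m + 1 => (req m).elim (grantList quota req m) fun w =>
      grantStep (quota w.1) (grantList quota req m) w

variable {quota : K → ℕ} {req : ℕ → Option (K × X)}

theorem grantList_induction {P : List (K × X) → Prop} (nil : P [])
    (append : ∀ L i w, P L → req i = some w → w ∉ L → L.countP (·.1 = w.1) < quota w.1 →
      P (L ++ [w])) (m : ℕ) : P (grantList quota req m) := by
  induction m with
  | zero => exact nil
  | succ m ih =>
    rw [grantList]
    rcases hw : req m with _ | w
    · exact ih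
    · rw [Option.elim_some, grantStep]
      split_ifs with h
      · exact append _ m w ih hw h.1 h.2
      · exact ih

theorem prefix_grantList {m m' : ℕ} (h : m ≤ m') :
    grantList quota req m <+: grantList quota req m' := by
  induction h with
  | refl => exact List.prefix_rfl
  | @step m' _ ih =>
    refine ih.trans ?_
    rw [grantList]
    rcases req m' with _ | w
    · exact List.prefix_rfl
    · rw [Option.elim_some, grantStep]
      split_ifs
      exacts [List.prefix_append _ _, List.prefix_rfl]

theorem nodup_grantList (m : ℕ) : (grantList quota req m).Nodup :=
  grantList_induction List.nodup_nil
    (fun L _ w hL _ hw _ => List.concat_eq_append (as := L) (a := w) ▸ List.Nodup.concat hw hL) m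

theorem exists_request_of_mem_grantList {m : ℕ} {w : K × X} :
    w ∈ grantList quota req m → ∃ i, req i = some w := by
  refine grantList_induction (P := fun L => w ∈ L → ∃ i, req i = some w) (by simp) ?_ m
  intro L i v hL hi _ _ hw
  rcases List.mem_append.1 hw with hw | hw
  · exact hL hw
  · exact ⟨i, by rw [hi, List.mem_singleton.1 hw]⟩

theorem countP_grantList_le (k : K) (m : ℕ) :
    (grantList quota req m).countP (·.1 = k) ≤ quota k := by
  refine grantList_induction (P := fun L => L.countP (·.1 = k) ≤ quota k) (by simp)
    (fun L _ w hL _ _ hlt => ?_) m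
  rw [List.countP_append, List.countP_singleton]
  by_cases hk : w.1 = k
  · subst hk
    simpa using hlt
  · simpa [hk] using hL

theorem length_grantList_le {B : ℕ}
    (hB : ∀ T : Finset K, (∀ k ∈ T, ∃ x i, req i = some (k, x)) → ∑ k ∈ T, quota k ≤ B)
    (m : ℕ) : (grantList quota req m).length ≤ B := by
  have hnodup := nodup_grantList (quota := quota) (req := req) m
  rw [← List.toFinset_card_of_nodup hnodup, card_eq_sum_card_image Prod.fst]
  refine (sum_le_sum fun k _ => ?_).trans (hB ((grantList quota req m).toFinset.image Prod.fst) ?_)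
  · rw [← countP_eq_card_filter_toFinset hnodup (·.1 = k)]
    exact countP_grantList_le k m
  · simp only [mem_image, List.mem_toFinset]
    rintro _ ⟨w, hw, rfl⟩
    exact ⟨w.2, exists_request_of_mem_grantList hw⟩

theorem mem_grantList_or_quota_le {i m : ℕ} {w : K × X} (hi : req i = some w) (hm : i < m) :
    w ∈ grantList quota req m ∨ quota w.1 ≤ (grantList quota req m).countP (·.1 = w.1) := by
  have hstep : w ∈ grantList quota req (i + 1) ∨
      quota w.1 ≤ (grantList quota req (i + 1)).countP (·.1 = w.1) := by
    rw [grantList, hi, Option.elim_some, grantStep]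
    split_ifs with h
    · simp
    · rwa [not_and_or, not_not, not_lt] at h
  have hpre := prefix_grantList (quota := quota) (req := req) hm
  exact hstep.imp (fun h => hpre.subset h) fun h => h.trans (hpre.sublist.countP_le)

theorem exists_quota_le_countP_grantList {k : K} {S : Finset X}
    (hS : ∀ x ∈ S, ∃ i, req i = some (k, x)) (hcard : quota k ≤ #S) :
    ∃ m, quota k ≤ (grantList quota req m).countP (·.1 = k) := by
  by_contra! hlt
  have hmem : ∀ x ∈ S, ∀ᶠ m in Filter.atTop, (k, x) ∈ grantList quota req m := fun x hx => by
    obtain ⟨i, hi⟩ := hS x hx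
    filter_upwards [Filter.eventually_gt_atTop i] with m hm
    exact (mem_grantList_or_quota_le hi hm).resolve_right (hlt m).not_ge
  obtain ⟨m, hm⟩ := ((Filter.eventually_all_finset S).2 hmem).exists
  refine (hlt m).not_ge (hcard.trans ?_)
  rw [countP_eq_card_filter_toFinset (nodup_grantList m),
    ← card_image_of_injective S (Prod.mk_right_injective k)]
  refine card_le_card fun w hw => ?_
  obtain ⟨x, hx, rfl⟩ := mem_image.1 hw
  simpa using hm x hx

theorem primrec_grantList [Primcodable K] [Primcodable X] {α : Type*} [Primcodable α]
    {quota : α → K → ℕ} {req : α → ℕ → Option (K × X)} (hquota : Primrec₂ quota)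
    (hreq : Primrec₂ req) : Primrec₂ fun a => grantList (quota a) (req a) := by
  have hmem : PrimrecRel fun (w : K × X) (L : List (K × X)) => w ∈ L :=
    (PrimrecRel.exists_mem_list Primrec.eq).swap.of_eq (by simp)
  have hcount : Primrec₂ fun (L : List (K × X)) (k : K) => L.countP (·.1 = k) :=
    primrec_countP Primrec.fst
      (Primrec.eq.comp (Primrec.fst.comp Primrec.snd) (Primrec.snd.comp Primrec.fst))
  have hstep : Primrec₂ fun (a : ℕ × List (K × X)) (w : K × X) => grantStep a.1 a.2 w := by
    have hL : Primrec fun a : (ℕ × List (K × X)) × (K × X) => a.1.2 := Primrec.snd.comp Primrec.fst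
    exact Primrec.ite
      ((hmem.comp Primrec.snd hL).not.and (Primrec.nat_lt.comp
        (hcount.comp hL (Primrec.fst.comp Primrec.snd)) (Primrec.fst.comp Primrec.fst)))
      (Primrec.list_append.comp hL (Primrec.list_cons.comp Primrec.snd (Primrec.const []))) hL
  have hrec : Primrec₂ fun (a : α) (b : ℕ × List (K × X)) =>
      (req a b.1).elim b.2 fun w => grantStep (quota a w.1) b.2 w := by
    have hL : Primrec fun b : (α × ℕ × List (K × X)) × (K × X) => b.1.2.2 :=
      Primrec.snd.comp (Primrec.snd.comp Primrec.fst)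
    refine (Primrec.option_casesOn (hreq.comp Primrec.fst (Primrec.fst.comp Primrec.snd))
      (Primrec.snd.comp Primrec.snd) (hstep.comp (Primrec.pair (hquota.comp
        (Primrec.fst.comp Primrec.fst) (Primrec.fst.comp Primrec.snd)) hL)
        Primrec.snd).to₂).of_eq fun a => ?_
    dsimp only
    rcases req a.1 a.2.1 <;> rfl
  refine (Primrec.nat_rec (Primrec.const []) hrec).of_eq fun a m => ?_
  induction m with
  | zero => rfl
  | succ m ih => simp only [grantList, ← ih]

end Quota

theorem primrec_idxOf_stringsOfLength :
    Primrec fun p : List Bool => (stringsOfLength p.length).idxOf p := by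
  refine (Primrec.list_idxOf.comp Primrec.id
    (primrec_stringsOfLength.comp Primrec.list_length)).of_eq fun p => ?_
  congr 1
  exact lawful_beq_subsingleton _ _

theorem plainComplexity_le {U : List Bool → List Bool →. List Bool} {p x y : List Bool}
    (hx : x ∈ U p y) : plainComplexity U x y ≤ p.length :=
  iInf₂_le p hx

theorem exists_machine_of_granted {K : Type*} [DecidableEq K] [Primcodable K]
    {quota : ℕ → K → ℕ} {req : ℕ → ℕ → Option (K × List Bool)} (hquota : Primrec₂ quota)
    (hreq : Primrec₂ req) (hlen : ∀ l m, (grantList (quota l) (req l) m).length ≤ 2 ^ l) :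
    ∃ V : List Bool → List Bool →. List Bool, Partrec₂ V ∧
      ∀ l m, ∀ w ∈ grantList (quota l) (req l) m, ∀ y, plainComplexity V w.2 y ≤ l := by
  -- The `i`-th program of length `l` describes the `i`-th granted request.
  let out : List Bool → ℕ → Option (List Bool) := fun p m =>
    ((grantList (quota p.length) (req p.length) m)[(stringsOfLength p.length).idxOf p]?).map
      Prod.snd
  have hout : Primrec₂ out :=
    Primrec.option_map (Primrec.list_getElem?.comp
      ((primrec_grantList hquota hreq).comp (Primrec.list_length.comp Primrec.fst) Primrec.snd)
      (primrec_idxOf_stringsOfLength.comp Primrec.fst)) (Primrec.snd.comp Primrec.snd)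
  have hmono : ∀ p {x m m'}, m ≤ m' → x ∈ out p m → x ∈ out p m' := by
    simp only [out, Option.mem_def, Option.map_eq_some_iff]
    rintro p x m m' hm ⟨w, hw, rfl⟩
    obtain ⟨hi, rfl⟩ := List.getElem?_eq_some_iff.1 hw
    exact ⟨_, List.prefix_iff_getElem?.1 (prefix_grantList hm) _ hi, rfl⟩
  refine ⟨fun p _ => Nat.rfindOpt (out p),
    (Partrec.rfindOpt hout.to_comp).comp Computable.fst, fun l m w hw y => ?_⟩
  obtain ⟨i, hi, rfl⟩ := List.mem_iff_getElem.1 hw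
  have hil : i < (stringsOfLength l).length := by
    rw [length_stringsOfLength]
    exact hi.trans_le (hlen l m)
  have hpl : (stringsOfLength l)[i].length = l := mem_stringsOfLength.1 (List.getElem_mem hil)
  have hmem : (grantList (quota l) (req l) m)[i].2 ∈ Nat.rfindOpt (out (stringsOfLength l)[i]) := by
    refine (Nat.rfindOpt_mono (hmono _)).2 ⟨m, ?_⟩
    simp only [out, hpl, (nodup_stringsOfLength l).idxOf_getElem i hil,
      List.getElem?_eq_getElem hi, Option.map_some, Option.mem_def]
  exact (plainComplexity_le hmem).trans_eq (by rw [hpl])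

theorem exists_machine_granting_requests {K : Type*} [Primcodable K]
    {R : ℕ → K × List Bool → Prop} {quota : ℕ → K → ℕ}
    (hR : REPred fun a : ℕ × K × List Bool => R a.1 a.2) (hquota : Primrec₂ quota)
    (hsum : ∀ l, ∀ T : Finset K, (∀ k ∈ T, ∃ x, R l (k, x)) → ∑ k ∈ T, quota l k ≤ 2 ^ l) :
    ∃ V : List Bool → List Bool →. List Bool, Partrec₂ V ∧
      ∀ l k, ∀ S : Finset (List Bool), (∀ x ∈ S, R l (k, x)) → quota l k ≤ #S →
        ∃ S' : Finset (List Bool), quota l k ≤ #S' ∧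
          ∀ x ∈ S', R l (k, x) ∧ ∀ y, plainComplexity V x y ≤ l := by
  classical
  obtain ⟨req, hreq, hiff⟩ := exists_primrec_enumeration_of_rePred hR
  have hlen (l m : ℕ) : (grantList (quota l) (req l) m).length ≤ 2 ^ l :=
    length_grantList_le (fun T hT => hsum l T fun k hk => by simpa only [hiff] using hT k hk) m
  obtain ⟨V, hV, hgranted⟩ := exists_machine_of_granted hquota hreq hlen
  refine ⟨V, hV, fun l k S hS hcard => ?_⟩
  obtain ⟨m, hm⟩ :=
    exists_quota_le_countP_grantList (fun x hx => (hiff l (k, x)).1 (hS x hx)) hcard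
  rw [countP_eq_card_filter_toFinset (nodup_grantList m) (·.1 = k)] at hm
  refine ⟨_, hm.trans_eq (card_image_of_injOn (f := Prod.snd) ?_).symm, ?_⟩
  · intro v hv w hw h
    simp only [coe_filter, Set.mem_ofPred_eq] at hv hw
    exact Prod.ext (hv.2.trans hw.2.symm) h
  · simp only [mem_image, mem_filter, List.mem_toFinset]
    rintro _ ⟨w, ⟨hw, rfl⟩, rfl⟩
    exact ⟨(hiff l w).2 (exists_request_of_mem_grantList hw), hgranted l m w hw⟩

section FiniteSums

theorem sum_eq_sum_image_fst {α β γ : Type*} [DecidableEq α] [DecidableEq β] [AddCommMonoid γ]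
    (T : Finset (α × β)) (f : α × β → γ) :
    ∑ p ∈ T, f p = ∑ a ∈ T.image Prod.fst, ∑ b ∈ ({p ∈ T | p.1 = a}).image Prod.snd, f (a, b) :=
  sum_finset_product T _ _ fun p => by aesop

theorem sum_half_pow_le {A : Finset ℕ} {c : ℝ} (hc : 0 < c) (hA : ∀ s ∈ A, c ≤ 2 ^ s) :
    ∑ s ∈ A, (1 / 2 : ℝ) ^ s ≤ 2 / c := by
  rcases A.eq_empty_or_nonempty with rfl | hne
  · rw [sum_empty]
    positivity
  set m := A.min' hne
  obtain ⟨N, hN⟩ : ∃ N, A ⊆ Ico m N :=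
    ⟨A.max' hne + 1, fun s hs => mem_Ico.2 ⟨A.min'_le s hs, Nat.lt_succ_of_le (A.le_max' s hs)⟩⟩
  calc ∑ s ∈ A, (1 / 2 : ℝ) ^ s ≤ ∑ s ∈ Ico m N, (1 / 2 : ℝ) ^ s :=
        sum_le_sum_of_subset_of_nonneg hN fun _ _ _ => by positivity
    _ = (1 / 2) ^ m * ∑ i ∈ range (N - m), (1 / 2 : ℝ) ^ i := by
        simp only [sum_Ico_eq_sum_range, pow_add, mul_sum]
    _ ≤ (1 / 2) ^ m * 2 := by
        gcongr
        exact sum_geometric_two_le _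
    _ = 2 / 2 ^ m := by
        rw [one_div, inv_pow, inv_mul_eq_div]
    _ ≤ 2 / c := by
        gcongr
        exact hA m (A.min'_mem hne)

end FiniteSums

/-- A total table of computations `(program, condition) ↦ output`, where `none` stands for a
computation without output. Both the stages of the simulation of a machine and, in
`Evaluator.limit`, the machine itself are presented in this form. -/
abbrev Evaluator := List Bool → List Bool → Option (List Bool)

namespace Evaluator

/-- `x` is the output of a program of length less than `b` under the condition `y`. -/
def ComplexityLT (o : Evaluator) (x y : List Bool) (b : ℕ) : Prop :=
  ∃ p ∈ stringsLT b, o p y = some x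

instance (o : Evaluator) (x y : List Bool) (b : ℕ) : Decidable (o.ComplexityLT x y b) := by
  unfold ComplexityLT
  infer_instance

/-- The number of programs of length less than `b` that output a string of length `n`. -/
def outCount (o : Evaluator) (n b : ℕ) : ℕ :=
  #{p ∈ (stringsLT b).toFinset | (o p []).map List.length = some n}

/-- At least the fraction `2 ^ (-s)` of the programs of length less than `b` output strings of
length `n`. -/
def Heavy (o : Evaluator) (n s b : ℕ) : Prop := 2 ^ b ≤ o.outCount n b * 2 ^ s

instance (o : Evaluator) (n s b : ℕ) : Decidable (o.Heavy n s b) := by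
  unfold Heavy
  infer_instance

/-- The number of heavy rows `k` with `i ≤ k < j`, where row `k` consists of the programs of length
less than `M * k`. -/
def heavyCount (o : Evaluator) (M n s i j : ℕ) : ℕ := #{k ∈ Ico i j | o.Heavy n s (M * k)}

/-- The number of light, i.e. not heavy, rows `k` with `i ≤ k < j`. -/
def lightCount (o : Evaluator) (M n s i j : ℕ) : ℕ := #{k ∈ Ico i j | ¬o.Heavy n s (M * k)}

/-- The number of `k` with `a ≤ k < b` whose complexity given `x` is less than `r`. -/
def simpleCount (o : Evaluator) (r a b : ℕ) (x : List Bool) : ℕ :=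
  #{k ∈ Ico a b | o.ComplexityLT k.bits x r}

/-- The condition under which the game on strings of length `n` is played at level `s`, with rows
`J ≤ j < 2 * J`: at least half of the rows are heavy at level `s + 1`, or `s` is so large that the
game is affordable for every `n`. -/
def Active (o : Evaluator) (M J n s : ℕ) : Prop :=
  J ≤ 2 * o.heavyCount M n (s + 1) J (2 * J) ∨ 4 * M * J ≤ 2 ^ s

/-- `x` may be given a description in row `j` of the game with rows below `T`: the values in
`[M * j, M * T)` that are simple given `x` are at least as many as the light rows above `j`. -/
def IsCandidate (o : Evaluator) (M T r n s j : ℕ) (x : List Bool) : Prop :=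
  x.length = n ∧ o.lightCount M n s (j + 1) T ≤ o.simpleCount r (M * j) (M * T) x

/-- `o'` contains all computations of `o` under the condition `y` with programs of length less than
`b`. -/
def ExtendsUpTo (o' o : Evaluator) (b : ℕ) (y : List Bool) : Prop :=
  ∀ p ∈ stringsLT b, ∀ z, o p y = some z → o' p y = some z

section Monotonicity

variable {o o' : Evaluator}

theorem ExtendsUpTo.anti {b b' : ℕ} {y : List Bool} (h : o'.ExtendsUpTo o b' y) (hb : b ≤ b') :
    o'.ExtendsUpTo o b y :=
  fun p hp => h p (mem_stringsLT.2 ((mem_stringsLT.1 hp).trans_le hb))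

theorem ComplexityLT.mono {b : ℕ} {x y : List Bool} (ho : o'.ExtendsUpTo o b y) :
    o.ComplexityLT x y b → o'.ComplexityLT x y b :=
  fun ⟨p, hp, h⟩ => ⟨p, hp, ho p hp x h⟩

theorem ComplexityLT.mono_right {b b' : ℕ} {x y : List Bool} (hb : b ≤ b') :
    o.ComplexityLT x y b → o.ComplexityLT x y b' :=
  fun ⟨p, hp, h⟩ => ⟨p, mem_stringsLT.2 ((mem_stringsLT.1 hp).trans_le hb), h⟩

theorem outCount_mono {n b : ℕ} (ho : o'.ExtendsUpTo o b []) :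
    o.outCount n b ≤ o'.outCount n b := by
  refine card_le_card fun p hp => ?_
  rw [mem_filter, Option.map_eq_some_iff] at hp ⊢
  obtain ⟨hp, z, hz, hn⟩ := hp
  exact ⟨hp, z, ho p (List.mem_toFinset.1 hp) z hz, hn⟩

theorem Heavy.mono {n s b : ℕ} (ho : o'.ExtendsUpTo o b []) (h : o.Heavy n s b) :
    o'.Heavy n s b :=
  h.trans (Nat.mul_le_mul_right _ (outCount_mono ho))

theorem lightCount_anti {M n s i j : ℕ} (ho : o'.ExtendsUpTo o (M * j) []) :
    o'.lightCount M n s i j ≤ o.lightCount M n s i j := by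
  refine card_le_card fun k hk => ?_
  rw [mem_filter] at hk ⊢
  have hkj : M * k ≤ M * j := Nat.mul_le_mul_left M (mem_Ico.1 hk.1).2.le
  exact ⟨hk.1, fun h => hk.2 (h.mono (ho.anti hkj))⟩

theorem heavyCount_mono {M n s i j : ℕ} (ho : o'.ExtendsUpTo o (M * j) []) :
    o.heavyCount M n s i j ≤ o'.heavyCount M n s i j := by
  refine card_le_card fun k hk => ?_
  rw [mem_filter] at hk ⊢
  have hkj : M * k ≤ M * j := Nat.mul_le_mul_left M (mem_Ico.1 hk.1).2.le
  exact ⟨hk.1, hk.2.mono (ho.anti hkj)⟩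

theorem simpleCount_mono {r a b : ℕ} {x : List Bool} (ho : o'.ExtendsUpTo o r x) :
    o.simpleCount r a b x ≤ o'.simpleCount r a b x := by
  refine card_le_card fun k hk => ?_
  rw [mem_filter] at hk ⊢
  exact ⟨hk.1, hk.2.mono ho⟩

theorem Active.mono {M J n s : ℕ} (ho : o'.ExtendsUpTo o (M * (2 * J)) [])
    (h : o.Active M J n s) : o'.Active M J n s :=
  h.imp_left fun h => h.trans (Nat.mul_le_mul_left 2 (heavyCount_mono ho))

theorem IsCandidate.mono {M T r n s j : ℕ} {x : List Bool} (ho : o'.ExtendsUpTo o (M * T) [])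
    (hox : o'.ExtendsUpTo o r x) (h : o.IsCandidate M T r n s j x) :
    o'.IsCandidate M T r n s j x :=
  ⟨h.1, (lightCount_anti ho).trans (h.2.trans (simpleCount_mono hox))⟩

end Monotonicity

section Primrec

variable {α : Type*} [Primcodable α] {o : α → Evaluator}

/-- A family of evaluators that is primitive recursive uniformly in the parameter. -/
def PrimrecFamily (o : α → Evaluator) : Prop :=
  Primrec fun a : α × List Bool × List Bool => o a.1 a.2.1 a.2.2

theorem PrimrecFamily.comp {β : Type*} [Primcodable β] (ho : PrimrecFamily o) {f : β → α}
    (hf : Primrec f) : PrimrecFamily fun b => o (f b) :=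
  Primrec.comp ho ((hf.comp Primrec.fst).pair Primrec.snd)

theorem PrimrecFamily.apply (ho : PrimrecFamily o) {p y : α → List Bool} (hp : Primrec p)
    (hy : Primrec y) : Primrec fun a => o a (p a) (y a) :=
  Primrec.comp ho (Primrec.id.pair (hp.pair hy))

theorem primrecPred_complexityLT (ho : PrimrecFamily o) {x y : α → List Bool} {b : α → ℕ}
    (hx : Primrec x) (hy : Primrec y) (hb : Primrec b) :
    PrimrecPred fun a => (o a).ComplexityLT (x a) (y a) (b a) :=
  primrecPred_exists_mem (primrec_stringsLT.comp hb) (Primrec.eq.comp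
    ((ho.comp Primrec.fst).apply Primrec.snd (hy.comp Primrec.fst))
    (Primrec.option_some.comp (hx.comp Primrec.fst)))

theorem primrec_outCount (ho : PrimrecFamily o) {n b : α → ℕ} (hn : Primrec n) (hb : Primrec b) :
    Primrec fun a => (o a).outCount (n a) (b a) :=
  primrec_card_filter_toFinset (fun _ => nodup_stringsLT _) (primrec_stringsLT.comp hb)
    (Primrec.eq.comp (Primrec.option_map
      ((ho.comp Primrec.fst).apply Primrec.snd (Primrec.const []))
      (Primrec.list_length.comp Primrec.snd))
    (Primrec.option_some.comp (hn.comp Primrec.fst)))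

theorem primrecPred_heavy (ho : PrimrecFamily o) {n s b : α → ℕ} (hn : Primrec n) (hs : Primrec s)
    (hb : Primrec b) : PrimrecPred fun a => (o a).Heavy (n a) (s a) (b a) :=
  Primrec.nat_le.comp (primrec_nat_pow.comp (Primrec.const 2) hb)
    (Primrec.nat_mul.comp (primrec_outCount ho hn hb)
      (primrec_nat_pow.comp (Primrec.const 2) hs))

theorem primrecRel_heavy_row (ho : PrimrecFamily o) {M n s : α → ℕ} (hM : Primrec M)
    (hn : Primrec n) (hs : Primrec s) :
    PrimrecRel fun a k => (o a).Heavy (n a) (s a) (M a * k) :=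
  primrecPred_heavy (ho.comp Primrec.fst) (hn.comp Primrec.fst) (hs.comp Primrec.fst)
    (Primrec.nat_mul.comp (hM.comp Primrec.fst) Primrec.snd)

theorem primrecPred_active (ho : PrimrecFamily o) {M J n s : α → ℕ} (hM : Primrec M)
    (hJ : Primrec J) (hn : Primrec n) (hs : Primrec s) :
    PrimrecPred fun a => (o a).Active (M a) (J a) (n a) (s a) := by
  have hcount : Primrec fun a => (o a).heavyCount (M a) (n a) (s a + 1) (J a) (2 * J a) :=
    primrec_card_filter_Ico hJ (Primrec.nat_mul.comp (Primrec.const 2) hJ)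
      (primrecRel_heavy_row ho hM hn (Primrec.succ.comp hs))
  exact (Primrec.nat_le.comp hJ (Primrec.nat_mul.comp (Primrec.const 2) hcount)).or
    (Primrec.nat_le.comp (Primrec.nat_mul.comp (Primrec.nat_mul.comp (Primrec.const 4) hM) hJ)
      (primrec_nat_pow.comp (Primrec.const 2) hs))

theorem primrecPred_isCandidate (ho : PrimrecFamily o) {M T r n s j : α → ℕ} {x : α → List Bool}
    (hM : Primrec M) (hT : Primrec T) (hr : Primrec r) (hn : Primrec n) (hs : Primrec s)
    (hj : Primrec j) (hx : Primrec x) :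
    PrimrecPred fun a => (o a).IsCandidate (M a) (T a) (r a) (n a) (s a) (j a) (x a) := by
  have hlight : Primrec fun a => (o a).lightCount (M a) (n a) (s a) (j a + 1) (T a) :=
    primrec_card_filter_Ico (Primrec.succ.comp hj) hT (primrecRel_heavy_row ho hM hn hs).not
  have hsimple : Primrec fun a => (o a).simpleCount (r a) (M a * j a) (M a * T a) (x a) :=
    primrec_card_filter_Ico (Primrec.nat_mul.comp hM hj) (Primrec.nat_mul.comp hM hT)
      (primrecPred_complexityLT (ho.comp Primrec.fst) (primrec_nat_bits.comp Primrec.snd)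
        (hx.comp Primrec.fst) (hr.comp Primrec.fst))
  exact (Primrec.eq.comp (Primrec.list_length.comp hx) hn).and (Primrec.nat_le.comp hlight hsimple)

end Primrec

section Requests

/-- The distance `M` between the length bounds of consecutive rows in the games for the overhead
`d`, i.e. against a `U` with `C_U ≤ C_V + d`. Descriptions for `2 ^ (M * j - s - (2 * d + 6))`
strings are affordable in row `j`, and `M` exceeds `2 * d + 6`. -/
def scale (d : ℕ) : ℕ := 2 * d + 7

/-- The row of the games for the overhead `d` in which descriptions of length `l` are used. -/
def row (l d : ℕ) : ℕ := (l + d + 1) / scale d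

/-- The first row of the games that contain the row `row l d`. -/
def firstRow (l d : ℕ) : ℕ := 2 ^ Nat.log 2 (row l d)

/-- In the game for the overhead `d` on strings of length `n` at level `s`, descriptions of
length `l` may be granted to `x`. The games with first row `J = 2 ^ (r + 1)` are played for
`2 * scale d * J ≤ n < 4 * scale d * J`, and there a number is simple given `x` if its complexity
given `x` is less than `r`. -/
def Requested (o : Evaluator) (l d n s : ℕ) (x : List Bool) : Prop :=
  2 * scale d * firstRow l d ≤ n ∧ n < 4 * scale d * firstRow l d ∧ d + s + 5 ≤ l ∧
    o.Active (scale d) (firstRow l d) n s ∧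
    o.IsCandidate (scale d) (2 * firstRow l d) (Nat.log 2 (row l d) - 1) n s (row l d) x

theorem Requested.exists_use_bound (l d n s : ℕ) (x : List Bool) :
    ∃ B, ∀ o o' : Evaluator, o'.ExtendsUpTo o B [] → o'.ExtendsUpTo o B x →
      o.Requested l d n s x → o'.Requested l d n s x := by
  refine ⟨max (scale d * (2 * firstRow l d)) (Nat.log 2 (row l d) - 1),
    fun o o' ho hox => ?_⟩
  rintro ⟨hn, hn', hs, hactive, hcand⟩
  have ho := ho.anti (le_max_left _ _)
  exact ⟨hn, hn', hs, hactive.mono ho, hcand.mono ho (hox.anti (le_max_right _ _))⟩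

theorem primrecPred_requested {α : Type*} [Primcodable α] {o : α → Evaluator}
    (ho : PrimrecFamily o) {l d n s : α → ℕ} {x : α → List Bool} (hl : Primrec l)
    (hd : Primrec d) (hn : Primrec n) (hs : Primrec s) (hx : Primrec x) :
    PrimrecPred fun a => (o a).Requested (l a) (d a) (n a) (s a) (x a) := by
  have hscale : Primrec fun a => scale (d a) :=
    Primrec.nat_add.comp (Primrec.nat_mul.comp (Primrec.const 2) hd) (Primrec.const 7)
  have hrow : Primrec fun a => row (l a) (d a) :=
    Primrec.nat_div.comp (Primrec.succ.comp (Primrec.nat_add.comp hl hd)) hscale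
  have hlog : Primrec fun a => Nat.log 2 (row (l a) (d a)) := primrec_nat_log_two.comp hrow
  have hfirst : Primrec fun a => firstRow (l a) (d a) :=
    primrec_nat_pow.comp (Primrec.const 2) hlog
  have hlength (c : ℕ) : Primrec fun a => c * scale (d a) * firstRow (l a) (d a) :=
    Primrec.nat_mul.comp (Primrec.nat_mul.comp (Primrec.const c) hscale) hfirst
  exact (Primrec.nat_le.comp (hlength 2) hn).and <| (Primrec.nat_lt.comp hn (hlength 4)).and <|
    (Primrec.nat_le.comp (Primrec.nat_add.comp (Primrec.nat_add.comp hd hs) (Primrec.const 5))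
      hl).and <|
    (primrecPred_active ho hscale hfirst hn hs).and <|
    primrecPred_isCandidate ho hscale (Primrec.nat_mul.comp (Primrec.const 2) hfirst)
      (Primrec.nat_sub.comp hlog (Primrec.const 1)) hn hs hrow hx

end Requests

section Limit

variable {U : List Bool → List Bool →. List Bool}

open Classical in
/-- The machine `U` as a table of computations, in which diverging computations have no output. -/
noncomputable def limit (U : List Bool → List Bool →. List Bool) : Evaluator :=
  fun p y => (U p y).toOption

theorem limit_eq_some_iff {p y z : List Bool} : limit U p y = some z ↔ z ∈ U p y := by
  classical
  rw [limit, ← Option.mem_def, Part.mem_toOption]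

theorem complexityLT_limit_iff {x y : List Bool} {b : ℕ} :
    (limit U).ComplexityLT x y b ↔ plainComplexity U x y < b := by
  simp only [ComplexityLT, plainComplexity, iInf_lt_iff, Set.mem_ofPred_eq, mem_stringsLT,
    limit_eq_some_iff, Nat.cast_lt, exists_prop]
  exact exists_congr fun p => and_comm

theorem eventually_extendsUpTo {o : Evaluator} {u : ℕ → Evaluator}
    (hmono : ∀ t t' p y z, t ≤ t' → u t p y = some z → u t' p y = some z)
    (hlim : ∀ p y z, o p y = some z → ∃ t, u t p y = some z) (B : ℕ) (y : List Bool) :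
    ∀ᶠ t in Filter.atTop, (u t).ExtendsUpTo o B y := by
  have hp : ∀ p ∈ (stringsLT B).toFinset, ∀ᶠ t in Filter.atTop,
      ∀ z, o p y = some z → u t p y = some z := by
    intro p _
    rcases hz : o p y with _ | z
    · simp
    · obtain ⟨t₀, ht₀⟩ := hlim p y z hz
      filter_upwards [Filter.eventually_ge_atTop t₀] with t ht w hw
      rw [← hw]
      exact hmono t₀ t p y z ht ht₀
  filter_upwards [(Filter.eventually_all_finset _).2 hp] with t ht p hpB
  exact ht p (List.mem_toFinset.2 hpB)

theorem rePred_requested (hU : Partrec₂ U) :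
    REPred fun a : ℕ × (ℕ × ℕ × ℕ) × List Bool =>
      (limit U).Requested a.1 a.2.1.1 a.2.1.2.1 a.2.1.2.2 a.2.2 := by
  obtain ⟨u, hu, hmono, hspec⟩ := exists_primrec_stages hU
  let stage : ℕ → Evaluator := fun t p y => u (p, y) t
  have hstage : PrimrecFamily stage := hu.comp Primrec.snd Primrec.fst
  have hmem : ∀ p y z, limit U p y = some z ↔ ∃ t, stage t p y = some z := fun p y z =>
    limit_eq_some_iff.trans (hspec (p, y) z)
  have hle (t B : ℕ) (y : List Bool) : (limit U).ExtendsUpTo (stage t) B y :=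
    fun p _ z hz => (hmem p y z).2 ⟨t, hz⟩
  have hge (B : ℕ) (y : List Bool) : ∀ᶠ t in Filter.atTop, (stage t).ExtendsUpTo (limit U) B y :=
    eventually_extendsUpTo (u := stage) (fun _ _ _ _ _ ht h => hmono ht h)
      (fun p y z => (hmem p y z).1) B y
  have hrel : PrimrecRel fun (a : ℕ × (ℕ × ℕ × ℕ) × List Bool) t =>
      (stage t).Requested a.1 a.2.1.1 a.2.1.2.1 a.2.1.2.2 a.2.2 := by
    have hkey : Primrec fun b : (ℕ × (ℕ × ℕ × ℕ) × List Bool) × ℕ => b.1.2.1 :=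
      Primrec.fst.comp (Primrec.snd.comp Primrec.fst)
    exact primrecPred_requested (hstage.comp Primrec.snd) (Primrec.fst.comp Primrec.fst)
      (Primrec.fst.comp hkey) (Primrec.fst.comp (Primrec.snd.comp hkey))
      (Primrec.snd.comp (Primrec.snd.comp hkey)) (Primrec.snd.comp (Primrec.snd.comp Primrec.fst))
  refine (rePred_exists_of_primrecRel hrel).of_eq fun a => ?_
  obtain ⟨B, hB⟩ := Requested.exists_use_bound a.1 a.2.1.1 a.2.1.2.1 a.2.1.2.2 a.2.2
  refine ⟨fun ⟨t, ht⟩ => hB _ _ (hle t B _) (hle t B _) ht, fun h => ?_⟩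
  obtain ⟨t, ht, htx⟩ := ((hge B []).and (hge B a.2.2)).exists
  exact ⟨t, hB _ _ ht htx h⟩

end Limit

section Counting

variable {o : Evaluator}

theorem card_lt_of_complexityLT {S : Finset (List Bool)} {y : List Bool} {b : ℕ}
    (hS : ∀ x ∈ S, o.ComplexityLT x y b) : #S < 2 ^ b := by
  have hsurj : Set.SurjOn (fun p => (o p y).getD []) (stringsLT b).toFinset S := by
    intro x hx
    obtain ⟨p, hp, h⟩ := hS x hx
    exact ⟨p, List.mem_toFinset.2 hp, by simp [h]⟩
  exact ((card_le_card_of_surjOn _ hsurj).trans (List.toFinset_card_le _)).trans_lt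
    (length_stringsLT_lt b)

theorem simpleCount_lt (r a b : ℕ) (x : List Bool) : o.simpleCount r a b x < 2 ^ r := by
  have hbits : Function.Injective Nat.bits := fun m n h => by
    rw [← Nat.digits_inj_iff (b := 2), Nat.digits_two_eq_bits, Nat.digits_two_eq_bits, h]
  rw [simpleCount, ← card_image_of_injective _ hbits]
  refine card_lt_of_complexityLT (o := o) (y := x) fun z hz => ?_
  obtain ⟨k, hk, rfl⟩ := mem_image.1 hz
  exact (mem_filter.1 hk).2

theorem card_le_outCount {S : Finset (List Bool)} {n b : ℕ}
    (hS : ∀ x ∈ S, x.length = n ∧ o.ComplexityLT x [] b) : #S ≤ o.outCount n b := by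
  refine card_le_card_of_surjOn (fun p => (o p []).getD []) fun x hx => ?_
  obtain ⟨hn, p, hp, h⟩ := hS x hx
  exact ⟨p, by simp [hp, h, hn], by simp [h]⟩

theorem sum_outCount_le (T : Finset ℕ) (b : ℕ) : ∑ n ∈ T, o.outCount n b ≤ 2 ^ b := by
  have h := sum_card_fiberwise_eq_card_filter (stringsLT b).toFinset (T.map .some)
    fun p => (o p []).map List.length
  rw [sum_map] at h
  exact h.trans_le ((card_filter_le _ _).trans
    ((List.toFinset_card_le _).trans (length_stringsLT_lt b).le))

theorem not_heavy_zero (n b : ℕ) : ¬o.Heavy n 0 b := by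
  have : o.outCount n b < 2 ^ b :=
    (card_filter_le _ _).trans_lt ((List.toFinset_card_le _).trans_lt (length_stringsLT_lt b))
  simpa [Heavy] using this

end Counting

section Budget

variable {o : Evaluator}

theorem sum_half_pow_heavy_le {n b : ℕ} {A : Finset ℕ} (hA : ∀ s ∈ A, o.Heavy n (s + 1) b) :
    ∑ s ∈ A, (1 / 2 : ℝ) ^ s ≤ 4 * (o.outCount n b / 2 ^ b) := by
  have hA' : ∀ s ∈ A, (2 : ℝ) ^ b ≤ o.outCount n b * 2 ^ (s + 1) := fun s hs => by
    exact_mod_cast hA s hs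
  rcases (o.outCount n b).eq_zero_or_pos with h0 | hpos
  · have : A = ∅ := eq_empty_of_forall_notMem fun s hs => by
      have := hA' s hs
      rw [h0, Nat.cast_zero, zero_mul] at this
      exact this.not_gt (by positivity)
    simp [this, h0]
  · have : (0 : ℝ) < o.outCount n b := Nat.cast_pos.2 hpos
    refine (sum_half_pow_le (c := 2 ^ b / (2 * o.outCount n b)) (by positivity)
      fun s hs => ?_).trans_eq (by field_simp; norm_num)
    rw [div_le_iff₀ (by positivity)]
    exact (hA' s hs).trans_eq (by ring)

theorem sum_half_pow_active_le {M J n : ℕ} (hM : 0 < M) (hJ : 0 < J) {A : Finset ℕ}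
    (hA : ∀ s ∈ A, o.Active M J n s) :
    ∑ s ∈ A, (1 / 2 : ℝ) ^ s ≤
      1 / (2 * M * J) + 8 / J * ∑ j ∈ Ico J (2 * J), (o.outCount n (M * j) / 2 ^ (M * j) : ℝ) := by
  have hpointwise : ∀ s ∈ A, (1 / 2 : ℝ) ^ s ≤ (if 4 * M * J ≤ 2 ^ s then (1 / 2 : ℝ) ^ s else 0) +
      2 / J * ∑ j ∈ Ico J (2 * J), if o.Heavy n (s + 1) (M * j) then (1 / 2 : ℝ) ^ s else 0 := by
    intro s hs
    rw [← sum_filter, sum_const, nsmul_eq_mul]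
    rcases hA s hs with h | h
    · have hhalf : (1 : ℝ) ≤ 2 / J * o.heavyCount M n (s + 1) J (2 * J) := by
        rw [div_mul_eq_mul_div, one_le_div (by positivity)]
        exact_mod_cast h
      rw [← mul_assoc]
      refine (le_mul_of_one_le_left (by positivity) hhalf).trans (le_add_of_nonneg_left ?_)
      split_ifs <;> positivity
    · rw [if_pos h]
      exact le_add_of_nonneg_right (by positivity)
  refine (sum_le_sum hpointwise).trans ?_
  rw [sum_add_distrib, ← mul_sum, sum_comm, ← sum_filter]
  refine add_le_add ?_ ?_
  · refine (sum_half_pow_le (c := 4 * M * J) (by positivity) fun s hs => ?_).trans_eq ?_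
    · exact_mod_cast (mem_filter.1 hs).2
    · field_simp
      norm_num
  · calc 2 / (J : ℝ) * ∑ j ∈ Ico J (2 * J), ∑ s ∈ A, (if o.Heavy n (s + 1) (M * j) then
          (1 / 2 : ℝ) ^ s else 0)
        ≤ 2 / J * ∑ j ∈ Ico J (2 * J), 4 * (o.outCount n (M * j) / 2 ^ (M * j) : ℝ) := by
          gcongr with j
          rw [← sum_filter]
          exact sum_half_pow_heavy_le fun s hs => (mem_filter.1 hs).2
      _ = _ := by
          rw [← mul_sum]
          ring

theorem sum_half_pow_active_block_le {M J : ℕ} (hM : 0 < M) (hJ : 0 < J) {T : Finset (ℕ × ℕ)}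
    (hT : ∀ p ∈ T, p.1 ∈ Ico (2 * M * J) (4 * M * J) ∧ o.Active M J p.1 p.2) :
    ∑ p ∈ T, (1 / 2 : ℝ) ^ p.2 ≤ 9 := by
  have hlevels (n : ℕ) :
      ∑ s ∈ ({p ∈ T | p.1 = n}).image Prod.snd, (1 / 2 : ℝ) ^ s ≤ 1 / (2 * M * J) +
        8 / J * ∑ j ∈ Ico J (2 * J), (o.outCount n (M * j) / 2 ^ (M * j) : ℝ) := by
    refine sum_half_pow_active_le hM hJ fun s hs => ?_
    obtain ⟨p, hp, rfl⟩ := mem_image.1 hs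
    rw [mem_filter] at hp
    exact hp.2 ▸ (hT p hp.1).2
  have hcard : (#(T.image Prod.fst) : ℝ) ≤ 2 * M * J := by
    have : #(T.image Prod.fst) ≤ #(Ico (2 * M * J) (4 * M * J)) :=
      card_le_card (image_subset_iff.2 fun p hp => (hT p hp).1)
    rw [Nat.card_Ico, ← Nat.sub_mul, ← Nat.sub_mul] at this
    exact_mod_cast this
  have hrow (j : ℕ) :
      ∑ n ∈ T.image Prod.fst, (o.outCount n (M * j) / 2 ^ (M * j) : ℝ) ≤ 1 := by
    rw [← sum_div, div_le_one (by positivity)]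
    exact_mod_cast sum_outCount_le _ (M * j)
  rw [sum_eq_sum_image_fst]
  refine (sum_le_sum fun n _ => hlevels n).trans ?_
  rw [sum_add_distrib, ← mul_sum, sum_comm, sum_const, nsmul_eq_mul]
  calc _ ≤ 2 * M * J * (1 / (2 * M * J) : ℝ) + 8 / J * ∑ _j ∈ Ico J (2 * J), (1 : ℝ) := by
        gcongr with j
        exact hrow j
    _ = 9 := by
        rw [sum_const, Nat.card_Ico, two_mul J, Nat.add_sub_cancel, nsmul_eq_mul]
        field_simp
        norm_num

theorem sum_quota_le (l : ℕ) {T : Finset (ℕ × ℕ × ℕ)}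
    (hT : ∀ k ∈ T, ∃ x, o.Requested l k.1 k.2.1 k.2.2 x) :
    ∑ k ∈ T, 2 ^ (l - (k.1 + k.2.2 + 5)) ≤ 2 ^ l := by
  have hquota : ∀ k ∈ T, (2 : ℝ) ^ (l - (k.1 + k.2.2 + 5)) =
      2 ^ l * ((1 / 2) ^ 5 * ((1 / 2) ^ k.1 * (1 / 2) ^ k.2.2)) := fun k hk => by
    obtain ⟨x, -, -, hl, -⟩ := hT k hk
    rw [pow_sub₀ _ two_ne_zero hl, one_div, ← pow_add, ← pow_add, inv_pow]
    congr 3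
    ring
  have hgames (d : ℕ) : ∑ p ∈ ({k ∈ T | k.1 = d}).image Prod.snd, (1 / 2 : ℝ) ^ p.2 ≤ 9 := by
    refine sum_half_pow_active_block_le (o := o) (M := scale d) (J := firstRow l d)
      (Nat.succ_pos _) (Nat.two_pow_pos _) fun p hp => ?_
    obtain ⟨k, hk, rfl⟩ := mem_image.1 hp
    rw [mem_filter] at hk
    obtain ⟨x, hn, hn', -, hactive, -⟩ := hT k hk.1
    exact hk.2 ▸ ⟨mem_Ico.2 ⟨hn, hn'⟩, hactive⟩
  have hoverheads : ∑ d ∈ T.image Prod.fst, (1 / 2 : ℝ) ^ d ≤ 2 := by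
    simpa using sum_half_pow_le one_pos fun d _ => one_le_pow₀ one_le_two
  have hreal : ∑ k ∈ T, (2 : ℝ) ^ (l - (k.1 + k.2.2 + 5)) ≤ 2 ^ l := by
    rw [sum_congr rfl hquota, ← mul_sum, ← mul_sum, sum_eq_sum_image_fst]
    refine mul_le_of_le_one_right (by positivity) ?_
    simp only [← mul_sum]
    calc (1 / 2 : ℝ) ^ 5 * ∑ d ∈ T.image Prod.fst, (1 / 2) ^ d *
          ∑ p ∈ ({k ∈ T | k.1 = d}).image Prod.snd, (1 / 2) ^ p.2
        ≤ (1 / 2) ^ 5 * ∑ d ∈ T.image Prod.fst, (1 / 2) ^ d * 9 := by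
          gcongr with d
          exact hgames d
      _ ≤ (1 / 2) ^ 5 * (2 * 9) := by
          rw [← sum_mul]
          gcongr
      _ ≤ 1 := by norm_num
  exact_mod_cast hreal

end Budget

section Game

variable {o : Evaluator} {M T r n s j : ℕ} {x : List Bool}

theorem heavyCount_add_lightCount (o : Evaluator) (M n s i j : ℕ) :
    o.heavyCount M n s i j + o.lightCount M n s i j = j - i := by
  rw [heavyCount, lightCount, card_filter_add_card_filter_not, Nat.card_Ico]

theorem lightCount_self : o.lightCount M n s j j = 0 := by
  rw [lightCount, Ico_self, filter_empty, card_empty]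

theorem Ico_subset_insert_Ico_succ (j T : ℕ) : Ico j T ⊆ insert j (Ico (j + 1) T) := fun k hk => by
  simp only [mem_insert, mem_Ico] at hk ⊢
  omega

theorem lightCount_le_succ (o : Evaluator) (M n s j T : ℕ) :
    o.lightCount M n s j T ≤ o.lightCount M n s (j + 1) T + 1 := by
  refine (card_le_card (filter_subset_filter _ (Ico_subset_insert_Ico_succ j T))).trans ?_
  rw [filter_insert]
  split_ifs
  · exact Nat.le_succ _
  · exact card_insert_le _ _

theorem lightCount_le_of_heavy (h : o.Heavy n s (M * j)) :
    o.lightCount M n s j T ≤ o.lightCount M n s (j + 1) T := by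
  refine (card_le_card (filter_subset_filter _ (Ico_subset_insert_Ico_succ j T))).trans ?_
  rw [filter_insert, if_neg (not_not_intro h), lightCount]

theorem simpleCount_succ_le {a a' b k : ℕ} (hak : a ≤ k) (hka : k < a') (hab : a' ≤ b)
    (hk : o.ComplexityLT k.bits x r) : o.simpleCount r a' b x + 1 ≤ o.simpleCount r a b x := by
  refine card_lt_card ((ssubset_iff_of_subset (filter_subset_filter _
    (Ico_subset_Ico_left (hak.trans hka.le)))).2 ⟨k, ?_, ?_⟩)
  · exact mem_filter.2 ⟨mem_Ico.2 ⟨hak, hka.trans_le hab⟩, hk⟩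
  · exact fun h => (mem_Ico.1 (mem_filter.1 h).1).1.not_gt hka

/-- The complexity of `x` is a number whose complexity given `x` is less than `r`. -/
def HasSimpleComplexity (o : Evaluator) (r : ℕ) (x : List Bool) : Prop :=
  ∃ k, o.ComplexityLT x [] (k + 1) ∧ ¬o.ComplexityLT x [] k ∧ o.ComplexityLT k.bits x r

/-- The invariant of the game after the rows from `T - 1` down to `j` have been played: whatever
lower bound `a ≤ M * j` for the complexity of `x` we know, at least as many of the values in
`[a, M * T)` are simple given `x` as there are light rows among those played. -/
def IsSurvivor (o : Evaluator) (M T r n s j : ℕ) (x : List Bool) : Prop :=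
  x.length = n ∧ ∀ a ≤ M * j, ¬o.ComplexityLT x [] a →
    o.lightCount M n s j T ≤ o.simpleCount r a (M * T) x

theorem isSurvivor_top (hx : x.length = n) : o.IsSurvivor M T r n s T x :=
  ⟨hx, fun _ _ _ => lightCount_self.trans_le (Nat.zero_le _)⟩

theorem IsSurvivor.isCandidate (h : o.IsSurvivor M T r n s (j + 1) x)
    (hx : ¬o.ComplexityLT x [] (M * j)) : o.IsCandidate M T r n s j x :=
  ⟨h.1, h.2 _ (Nat.mul_le_mul_left M j.le_succ) hx⟩

theorem IsSurvivor.of_heavy (h : o.IsSurvivor M T r n s (j + 1) x)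
    (hj : o.Heavy n s (M * j)) : o.IsSurvivor M T r n s j x :=
  ⟨h.1, fun a ha hxa => (lightCount_le_of_heavy hj).trans
    (h.2 a (ha.trans (Nat.mul_le_mul_left M j.le_succ)) hxa)⟩

theorem IsCandidate.isSurvivor (h : o.IsCandidate M T r n s j x) (hjT : j ≤ T)
    (hlt : o.ComplexityLT x [] (M * j)) (hx : o.HasSimpleComplexity r x) :
    o.IsSurvivor M T r n s j x := by
  obtain ⟨k, hk, hk', hsimple⟩ := hx
  refine ⟨h.1, fun a _ hxa => ?_⟩
  have hak : a ≤ k := not_lt.1 fun hka => hxa (hk.mono_right hka)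
  have hkj : k < M * j := not_le.1 fun hjk => hk' (hlt.mono_right hjk)
  calc o.lightCount M n s j T ≤ o.lightCount M n s (j + 1) T + 1 := lightCount_le_succ ..
    _ ≤ o.simpleCount r (M * j) (M * T) x + 1 := Nat.succ_le_succ h.2
    _ ≤ o.simpleCount r a (M * T) x :=
      simpleCount_succ_le hak hkj (Nat.mul_le_mul_left M hjT) hsimple

/-- Any `q` candidates in row `j` force `q` candidates with complexity less than `M * j`. -/
def Serves (o : Evaluator) (M T r n s j q : ℕ) : Prop :=
  ∀ S : Finset (List Bool), (∀ x ∈ S, o.IsCandidate M T r n s j x) → q ≤ #S →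
    ∃ S' : Finset (List Bool), q ≤ #S' ∧
      ∀ x ∈ S', o.IsCandidate M T r n s j x ∧ o.ComplexityLT x [] (M * j)

theorem card_filter_complexityLT_lt_of_light {e : ℕ} {S : Finset (List Bool)}
    (hS : ∀ x ∈ S, x.length = n) (hlight : ¬o.Heavy n s (M * j)) (hse : s + e ≤ M * j) :
    #{x ∈ S | o.ComplexityLT x [] (M * j)} < 2 ^ (M * j - (s + e)) * 2 ^ e := by
  have hout : o.outCount n (M * j) * 2 ^ s < 2 ^ (M * j - (s + e)) * 2 ^ e * 2 ^ s := by
    rw [mul_assoc, ← pow_add, ← pow_add, add_comm e, Nat.sub_add_cancel hse]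
    exact not_le.1 hlight
  refine (card_le_outCount fun x hx => ?_).trans_lt (lt_of_mul_lt_mul_right hout (Nat.zero_le _))
  exact ⟨hS x (mem_filter.1 hx).1, (mem_filter.1 hx).2⟩

theorem exists_survivors_of_light {e : ℕ} (hjT : j ≤ T) (hse : s + e ≤ (e + 1) * j)
    (hlight : ¬o.Heavy n s ((e + 1) * j))
    (hsimple : ∀ x : List Bool, x.length = n → o.HasSimpleComplexity r x)
    (hserves : o.Serves (e + 1) T r n s j (2 ^ ((e + 1) * j - (s + e)))) {S : Finset (List Bool)}
    (hcard : 2 ^ ((e + 1) * (j + 1) - (s + e)) ≤ #S)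
    (hS : ∀ x ∈ S, o.IsSurvivor (e + 1) T r n s (j + 1) x) :
    ∃ S' : Finset (List Bool), 2 ^ ((e + 1) * j - (s + e)) ≤ #S' ∧
      ∀ x ∈ S', o.IsSurvivor (e + 1) T r n s j x := by
  have hlow := card_filter_complexityLT_lt_of_light (fun x hx => (hS x hx).1) hlight hse
  have hsplit := card_filter_add_card_filter_not (s := S)
    fun x => o.ComplexityLT x [] ((e + 1) * j)
  rw [Nat.mul_succ, Nat.sub_add_comm hse, pow_add, pow_succ, ← mul_assoc] at hcard
  have hle := Nat.le_mul_of_pos_right (2 ^ ((e + 1) * j - (s + e))) (Nat.two_pow_pos e)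
  obtain ⟨S', hcard', hS'⟩ := hserves {x ∈ S | ¬o.ComplexityLT x [] ((e + 1) * j)}
    (fun x hx => (hS x (mem_filter.1 hx).1).isCandidate (mem_filter.1 hx).2) (by omega)
  exact ⟨S', hcard', fun x hx => (hS' x hx).1.isSurvivor hjT (hS' x hx).2
    (hsimple x (hS' x hx).1.1)⟩

theorem exists_survivors {e J : ℕ} (hJT : J ≤ T) (hse : s + e ≤ (e + 1) * J)
    (hn : (e + 1) * T ≤ n)
    (hsimple : ∀ x : List Bool, x.length = n → o.HasSimpleComplexity r x)
    (hserves : ∀ j, J ≤ j → j < T → o.Serves (e + 1) T r n s j (2 ^ ((e + 1) * j - (s + e)))) :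
    ∃ S : Finset (List Bool), 2 ^ ((e + 1) * J - (s + e)) ≤ #S ∧
      ∀ x ∈ S, o.IsSurvivor (e + 1) T r n s J x := by
  refine Nat.decreasingInduction' (fun j hjT hJj ⟨S, hcard, hS⟩ => ?_) hJT
    ⟨(stringsOfLength n).toFinset, ?_, fun x hx =>
      isSurvivor_top (mem_stringsOfLength.1 (List.mem_toFinset.1 hx))⟩
  · by_cases hj : o.Heavy n s ((e + 1) * j)
    · exact ⟨S, (Nat.pow_le_pow_right two_pos (Nat.sub_le_sub_right
        (Nat.mul_le_mul_left _ j.le_succ) _)).trans hcard, fun x hx => (hS x hx).of_heavy hj⟩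
    · exact exists_survivors_of_light hjT.le (hse.trans (Nat.mul_le_mul_left _ hJj)) hj hsimple
        (hserves j hJj hjT) hcard hS
  · rw [List.toFinset_card_of_nodup (nodup_stringsOfLength n), length_stringsOfLength]
    exact Nat.pow_le_pow_right two_pos ((Nat.sub_le _ _).trans hn)

theorem lightCount_lt {e J : ℕ} (hJT : J ≤ T) (hse : s + e ≤ (e + 1) * J) (hn : (e + 1) * T ≤ n)
    (hsimple : ∀ x : List Bool, x.length = n → o.HasSimpleComplexity r x)
    (hserves : ∀ j, J ≤ j → j < T → o.Serves (e + 1) T r n s j (2 ^ ((e + 1) * j - (s + e)))) :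
    o.lightCount (e + 1) n s J T < 2 ^ r := by
  obtain ⟨S, hcard, hS⟩ := exists_survivors hJT hse hn hsimple hserves
  obtain ⟨x, hx⟩ := card_pos.1 ((Nat.two_pow_pos _).trans_le hcard)
  have hzero : ¬o.ComplexityLT x [] 0 := fun ⟨p, hp, _⟩ =>
    Nat.not_lt_zero _ (mem_stringsLT.1 hp)
  exact ((hS x hx).2 0 (Nat.zero_le _) hzero).trans_lt (simpleCount_lt _ _ _ _)

theorem exists_active_balanced (o : Evaluator) (M n r : ℕ) :
    ∃ s ≤ r + 3 + M, o.Active M (2 ^ (r + 1)) n s ∧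
      2 ^ r ≤ o.lightCount M n s (2 ^ (r + 1)) (2 * 2 ^ (r + 1)) := by
  classical
  have hlast : o.Active M (2 ^ (r + 1)) n (r + 3 + M) := by
    refine .inr ?_
    calc 4 * M * 2 ^ (r + 1) ≤ 4 * 2 ^ M * 2 ^ (r + 1) := by
          gcongr
          exact Nat.lt_two_pow_self.le
      _ = 2 ^ (r + 3 + M) := by ring
  refine ⟨Nat.find ⟨_, hlast⟩, Nat.find_min' _ hlast, Nat.find_spec ⟨_, hlast⟩, ?_⟩
  have hhalf : 2 * o.heavyCount M n (Nat.find ⟨_, hlast⟩) (2 ^ (r + 1)) (2 * 2 ^ (r + 1))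
      ≤ 2 ^ (r + 1) := by
    rcases hs : Nat.find ⟨_, hlast⟩ with _ | s
    · simp [heavyCount, not_heavy_zero]
    · have hs' : ¬o.Active M (2 ^ (r + 1)) n s := Nat.find_min ⟨_, hlast⟩ (by omega)
      exact (not_le.1 (not_or.1 hs').1).le
  have hsum := o.heavyCount_add_lightCount M n (Nat.find ⟨_, hlast⟩) (2 ^ (r + 1))
    (2 * 2 ^ (r + 1))
  rw [pow_succ] at *
  omega

end Game

end Evaluator

section OptimalMachine

open Evaluator

variable {U : List Bool → List Bool →. List Bool}

theorem row_scale_mul_sub (d : ℕ) {j : ℕ} (hj : 0 < j) :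
    row (scale d * j - (d + 1)) d = j := by
  have hd : d + 1 ≤ scale d * j := by
    unfold scale
    nlinarith
  rw [row, add_assoc, Nat.sub_add_cancel hd]
  exact Nat.mul_div_cancel_left j (Nat.succ_pos _)

theorem requested_iff {o : Evaluator} {l d r n s : ℕ} {x : List Bool}
    (hlog : Nat.log 2 (row l d) = r + 1) (hn : 2 * scale d * 2 ^ (r + 1) ≤ n)
    (hn' : n < 4 * scale d * 2 ^ (r + 1)) (hl : d + s + 5 ≤ l)
    (hactive : o.Active (scale d) (2 ^ (r + 1)) n s) :
    o.Requested l d n s x ↔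
      o.IsCandidate (scale d) (2 * 2 ^ (r + 1)) r n s (row l d) x := by
  simp only [Requested, firstRow, hlog, hn, hn', hl, hactive, true_and, Nat.add_sub_cancel]

theorem IsOptimalMachine.exists_short_of_requested (hU : IsOptimalMachine U) :
    ∃ d, ∀ l n s, ∀ S : Finset (List Bool), (∀ x ∈ S, (limit U).Requested l d n s x) →
      2 ^ (l - (d + s + 5)) ≤ #S → ∃ S' : Finset (List Bool), 2 ^ (l - (d + s + 5)) ≤ #S' ∧
        ∀ x ∈ S', (limit U).Requested l d n s x ∧ (limit U).ComplexityLT x [] (l + d + 1) := by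
  have hquota : Primrec₂ fun (l : ℕ) (k : ℕ × ℕ × ℕ) => 2 ^ (l - (k.1 + k.2.2 + 5)) :=
    primrec_nat_pow.comp (Primrec.const 2) (Primrec.nat_sub.comp Primrec.fst
      (Primrec.nat_add.comp (Primrec.nat_add.comp (Primrec.fst.comp Primrec.snd)
        (Primrec.snd.comp (Primrec.snd.comp Primrec.snd))) (Primrec.const 5)))
  obtain ⟨V, hV, hgrant⟩ := exists_machine_granting_requests (K := ℕ × ℕ × ℕ)
    (R := fun l a => (limit U).Requested l a.1.1 a.1.2.1 a.1.2.2 a.2) (rePred_requested hU.1)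
    hquota fun l T => sum_quota_le l
  obtain ⟨d, hd⟩ := hU.2 V hV
  refine ⟨d, fun l n s S hS hcard => ?_⟩
  obtain ⟨S', hcard', hS'⟩ := hgrant l (d, n, s) S hS hcard
  refine ⟨S', hcard', fun x hx => ⟨(hS' x hx).1, complexityLT_limit_iff.2 ?_⟩⟩
  calc plainComplexity U x [] ≤ plainComplexity V x [] + d := hd x []
    _ ≤ l + d := by
      gcongr
      exact (hS' x hx).2 []
    _ < ((l + d + 1 : ℕ) : ℕ∞) := by exact_mod_cast (l + d).lt_succ_self

theorem IsOptimalMachine.exists_serves (hU : IsOptimalMachine U) :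
    ∃ d, ∀ r n s j, 2 * scale d * 2 ^ (r + 1) ≤ n → n < 4 * scale d * 2 ^ (r + 1) →
      s + (2 * d + 6) ≤ scale d * 2 ^ (r + 1) →
      (limit U).Active (scale d) (2 ^ (r + 1)) n s → 2 ^ (r + 1) ≤ j → j < 2 * 2 ^ (r + 1) →
      (limit U).Serves (scale d) (2 * 2 ^ (r + 1)) r n s j
        (2 ^ (scale d * j - (s + (2 * d + 6)))) := by
  obtain ⟨d, hshort⟩ := hU.exists_short_of_requested
  refine ⟨d, fun r n s j hn hn' hs hactive hj hj' S hS hcard => ?_⟩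
  have hsj : s + (2 * d + 6) ≤ scale d * j := hs.trans (Nat.mul_le_mul_left _ hj)
  have hrow := row_scale_mul_sub d ((Nat.two_pow_pos _).trans_le hj)
  have hlog : Nat.log 2 j = r + 1 :=
    Nat.log_eq_of_pow_le_of_lt_pow hj (by rwa [pow_succ' 2 (r + 1)])
  obtain ⟨l, hl⟩ : ∃ l, scale d * j = l + d + 1 :=
    ⟨scale d * j - (d + 1), by omega⟩
  rw [hl, add_assoc, Nat.add_sub_cancel] at hrow
  rw [hl, show l + d + 1 - (s + (2 * d + 6)) = l - (d + s + 5) by omega] at hcard ⊢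
  subst hrow
  have hiff (x : List Bool) := requested_iff (o := limit U) (x := x) hlog hn hn' (by omega) hactive
  obtain ⟨S', hcard', hS'⟩ := hshort l n s S (fun x hx => (hiff x).2 (hS x hx)) hcard
  exact ⟨S', hcard', fun x hx => ⟨(hiff x).1 (hS' x hx).1, hl ▸ (hS' x hx).2⟩⟩

theorem IsOptimalMachine.exists_eq_natCast (hU : IsOptimalMachine U) (x y : List Bool) :
    ∃ k : ℕ, plainComplexity U x y = k := by
  obtain ⟨d, hd⟩ := hU.2 (fun p _ => Part.some p) Computable.fst
  have hle : plainComplexity U x y ≤ ((x.length + d : ℕ) : ℕ∞) := by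
    have hself : plainComplexity (fun p _ => Part.some p) x y ≤ x.length :=
      plainComplexity_le (Part.mem_some x)
    rw [Nat.cast_add]
    exact (hd x y).trans (add_le_add_left hself _)
  exact ENat.ne_top_iff_exists.1 (ne_top_of_le_ne_top (ENat.natCast_ne_top _) hle) |>.imp
    fun _ => Eq.symm

theorem hasSimpleComplexity_limit {r k : ℕ} {x : List Bool} (hk : plainComplexity U x [] = k)
    (hsimple : plainComplexity U k.bits x < r) : (limit U).HasSimpleComplexity r x := by
  refine ⟨k, complexityLT_limit_iff.2 ?_, fun h => ?_, complexityLT_limit_iff.2 hsimple⟩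
  · rw [hk, Nat.cast_lt]
    exact k.lt_succ_self
  · rw [complexityLT_limit_iff, hk] at h
    exact h.false

theorem IsOptimalMachine.exists_complexity_not_simple (hU : IsOptimalMachine U) :
    ∃ M > 0, ∀ r n : ℕ, 1 ≤ r → 2 * M * 2 ^ (r + 1) ≤ n →
      n < 4 * M * 2 ^ (r + 1) → ∃ x : List Bool, x.length = n ∧
        ∃ k : ℕ, plainComplexity U x [] = k ∧ r ≤ plainComplexity U k.bits x := by
  obtain ⟨d, hserves⟩ := hU.exists_serves
  refine ⟨scale d, Nat.succ_pos _, fun r n hr hn hn' => ?_⟩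
  by_contra! hcontra
  have hsimple (x : List Bool) (hx : x.length = n) : (limit U).HasSimpleComplexity r x := by
    obtain ⟨k, hk⟩ := hU.exists_eq_natCast x []
    exact hasSimpleComplexity_limit hk (hcontra x hx k hk)
  obtain ⟨s, hs, hactive, hlight⟩ := exists_active_balanced (limit U) (scale d) n r
  have hsJ : s + (2 * d + 6) ≤ scale d * 2 ^ (r + 1) := by
    have hr' : r + 3 ≤ 2 ^ (r + 1) := by
      have := Nat.succ_le_of_lt (Nat.lt_two_pow_self (n := r))
      have := Nat.pow_le_pow_right two_pos hr
      rw [pow_succ]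
      omega
    unfold scale at *
    nlinarith
  refine hlight.not_gt (lightCount_lt (e := 2 * d + 6) (Nat.le_mul_of_pos_left _ two_pos) hsJ
    ?_ hsimple fun j hj hj' => hserves r n s j hn hn' hsJ hactive hj hj')
  exact hn.trans_eq' (by rw [scale]; ring)

theorem exists_mem_dyadic_block {M n : ℕ} (hM : 0 < M) (hn : 8 * M ≤ n) :
    ∃ r ≥ 1, 2 * M * 2 ^ (r + 1) ≤ n ∧ n < 4 * M * 2 ^ (r + 1) := by
  have hquot : 2 ^ 2 ≤ n / (2 * M) := (Nat.le_div_iff_mul_le (by positivity)).2 (by omega)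
  have hlog : 2 ≤ Nat.log 2 (n / (2 * M)) := Nat.le_log_of_pow_le one_lt_two hquot
  obtain ⟨r, hr⟩ := Nat.exists_eq_add_of_le' hlog
  have hlow : 2 ^ (r + 2) ≤ n / (2 * M) := hr ▸ Nat.pow_log_le_self 2 (by omega)
  have hup : n / (2 * M) < 2 ^ (r + 3) := by
    simpa only [hr] using Nat.lt_pow_succ_log_self one_lt_two (n / (2 * M))
  rw [Nat.le_div_iff_mul_le (by positivity)] at hlow
  rw [Nat.div_lt_iff_lt_mul (by positivity)] at hup
  exact ⟨r + 1, by omega, hlow.trans_eq' (by ring), hup.trans_eq (by ring)⟩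

theorem IsOptimalMachine.exists_lt_two_pow (hU : IsOptimalMachine U) :
    ∃ c, ∀ n, ∃ x : List Bool, x.length = n ∧ ∃ k m : ℕ, plainComplexity U x [] = k ∧
      plainComplexity U k.bits x = m ∧ n < 2 ^ (m + c) := by
  obtain ⟨M, hM, hlarge⟩ := hU.exists_complexity_not_simple
  refine ⟨8 * M, fun n => ?_⟩
  rcases lt_or_ge n (8 * M) with hn | hn
  · obtain ⟨k, hk⟩ := hU.exists_eq_natCast (List.replicate n false) []
    obtain ⟨m, hm⟩ := hU.exists_eq_natCast k.bits (List.replicate n false)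
    exact ⟨_, List.length_replicate, k, m, hk, hm, (hn.trans Nat.lt_two_pow_self).trans_le
      (Nat.pow_le_pow_right two_pos (Nat.le_add_left _ _))⟩
  · obtain ⟨r, hr, hlow, hup⟩ := exists_mem_dyadic_block hM hn
    obtain ⟨x, hx, k, hk, hrk⟩ := hlarge r n hr hlow hup
    obtain ⟨m, hm⟩ := hU.exists_eq_natCast k.bits x
    have hrm : r ≤ m := by rwa [hm, Nat.cast_le] at hrk
    refine ⟨x, hx, k, m, hk, hm, ?_⟩
    calc n < 4 * M * 2 ^ (r + 1) := hup
      _ = 2 ^ r * (8 * M) := by ring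
      _ ≤ 2 ^ m * 2 ^ (8 * M) := by
        gcongr
        · exact one_le_two
        · exact Nat.lt_two_pow_self.le
      _ = 2 ^ (m + 8 * M) := (pow_add ..).symm

end OptimalMachine

/-- Natural numbers are presented to machines in binary (`Nat.bits`), an unconditional complexity
is conditional on the empty string, and `k`, `m` are the natural numbers `C(x)`, `C(C(x) | x)`. -/
theorem theorem1 (U : List Bool → List Bool →. List Bool) (hU : IsOptimalMachine U) :
    ∃ c : ℕ, ∀ n : ℕ, ∃ x : List Bool, x.length = n ∧
      ∃ k m : ℕ, plainComplexity U x [] = (k : ℕ∞) ∧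
        plainComplexity U (Nat.bits k) x = (m : ℕ∞) ∧
          Real.logb 2 (n : ℝ) - (c : ℝ) ≤ (m : ℝ) := by
  obtain ⟨c, hc⟩ := hU.exists_lt_two_pow
  refine ⟨c, fun n => ?_⟩
  obtain ⟨x, hx, k, m, hk, hm, hn⟩ := hc n
  refine ⟨x, hx, k, m, hk, hm, ?_⟩
  rcases n.eq_zero_or_pos with rfl | hpos
  · simp only [Nat.cast_zero, Real.logb_zero, zero_sub]
    linarith [m.cast_nonneg (α := ℝ), c.cast_nonneg (α := ℝ)]
  · rw [sub_le_iff_le_add, Real.logb_le_iff_le_rpow one_lt_two (Nat.cast_pos.2 hpos)]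
    exact_mod_cast hn.le
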